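/- **Theorem (Higher Order Linear Loss).** Let $\mathbf V_i := f_i(\mathbf V_{\mathrm{pa}(i)})+\mathbf U_i$, $i=1,\dots,n$, be a linear SCM (an additive noise model over an acyclic graph with linear $f_i$), let $\mathcal I\subseteq\{1,\dots,n\}$ be the indices of the sensitive attributes, $\mathcal A\subseteq\mathbb R^{\mathcal I}$ the set of sensitive levels, $P_{\mathcal A}$, $P_{\mathcal X}$ the projections onto the coordinates in $\mathcal I$ and outside $\mathcal I$, and $\mathcal V=\{v\in\mathbb R^n: P_{\mathcal A}(v)\in\mathcal A\}$ the feature space. Let $g(v)_i=v_i$ for $i\in\mathcal I$ and $g(v)_i=v_i-f_i(v_{\mathrm{pa}(i)})$ for $i\notin\mathcal I$, and let $M$ be the matrix of the linear map $g^{-1}$. For $v\in\mathcal V$ and $a\in\mathcal A$ let $\ddot v_a$ be the twin of $v$, i.e. its counterfactual under the hard intervention setting the sensitive attributes to $a$. Let $\|\cdot\|$ be a norm on $\mathbb R^{\{1,\dots,n\}\setminus\mathcal I}$ with dual norm $\|x\|_*=\sup\{x^Tx':\|x'\|\le1\}$, let $p\in[1,\infty)$, $\delta\ge0$, and on $\mathcal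 V\times\mathbb R$ let $$c((v,y),(v',y'))=\|P_{\mathcal X}(g(v))-P_{\mathcal X}(g(v'))\|+\infty\cdot|y-y'|,\qquad W_{c,p}(\mathbb P,\mathbb Q)=\inf_{\pi}\big(\mathbb E_\pi[c^p]\big)^{1/p},$$ the infimum being over the couplings $\pi$ of $\mathbb P$ and $\mathbb Q$. Let $\ell(v,y,\theta)=h(y-\langle\theta,v\rangle)$ or $\ell(v,y,\theta)=h(y\cdot\langle\theta,v\rangle)$, where $h(t)$ is one of $|t|$, $\max(0,t)$, $|t-\tau|$, $\max(0,t-\tau)$ with $\tau\in\mathbb R$. Let $\mathbb P_N=\frac1N\sum_{k=1}^N\delta_{(v^k,y^k)}$, $N\ge1$, with $(v^k,y^k)\in\mathcal V\times\mathbb R$, and $y^k\in\{-1,1\}$ for losses of the second form. Put $$\mathcal R_\delta=\sup_{\mathbb Q:\,W_{c,p}(\mathbb P_N,\mathbb Q)\le\delta}\mathbb E_{\mathbb Q}[\ell(\cdot,\theta)^p],\qquad \mathcal R=\mathbb E_{\mathbb P_N}[\ell(\cdot,\theta)^p],\qquad \mathcal R^{cf}=\mathbb E_{(v,y)\sim\mathbb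 P_N}\Big[\sup_{a\in\mathcal A}\ell(\ddot v_a,y,\theta)^p\Big],$$ with values in $[0,\infty]$. Then for every $\theta\in\mathbb R^n$: 1. If $\operatorname{diam}\mathcal A<\infty$, then $\mathcal R_\delta=\big((\mathcal R^{cf})^{1/p}+\delta\|P_{\mathcal X}(M^T\theta)\|_*\big)^p$. 2. If $\operatorname{diam}\mathcal A=\infty$ and $P_{\mathcal A}(M^T\theta)=0$, then $\mathcal R_\delta=\big(\mathcal R^{1/p}+\delta\|P_{\mathcal X}(M^T\theta)\|_*\big)^p$. Moreover, the constraint is necessary: if $\operatorname{diam}\mathcal A=\infty$, $P_{\mathcal A}(M^T\theta)\neq0$, and $a\mapsto h(\langle w,a\rangle)$ is unbounded on $\mathcal A$ for every nonzero $w\in\mathbb R^{\mathcal I}$ (for instance if $\mathcal A=\mathbb R^{\mathcal I}$), then $\mathcal R_\delta=\infty$. -/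

import Mathlib

open MeasureTheory
open scoped ENNReal Matrix

/-! ### Structural causal models -/

/-- The structural equations `V i := f i (V restricted to the parents of i) (U i)` of a structural
causal model over an acyclic directed graph; `edge j i` means that `j` is a parent of `i`. -/
structure StructuralEquations (ι : Type*) where
  edge : ι → ι → Prop
  acyclic : ∀ i, ¬ Relation.TransGen edge i i
  f : ι → (ι → ℝ) → ℝ → ℝ
  f_parents : ∀ i v v' u, (∀ j, edge j i → v j = v' j) → f i v u = f i v' u

namespace StructuralEquations

variable {ι : Type*} [Finite ι]

theorem wellFounded_edge (S : StructuralEquations ι) : WellFounded S.edge := by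
  have : IsTrans ι (Relation.TransGen S.edge) := ⟨fun _ _ _ h h' => h.trans h'⟩
  have : Std.Irrefl (Relation.TransGen S.edge) := ⟨S.acyclic⟩
  exact Subrelation.wf (fun h => Relation.TransGen.single h)
    (Finite.wellFounded_of_trans_of_irrefl (Relation.TransGen S.edge))

open Classical in
/-- The reduced-form map `F : u ↦ v`, which solves the structural equations along the graph. -/
noncomputable def reducedForm (S : StructuralEquations ι) (u : ι → ℝ) : ι → ℝ :=
  S.wellFounded_edge.fix fun i rec =>
    S.f i (fun j => if h : S.edge j i then rec j h else 0) (u i)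

/-- `F u` solves the structural equations. -/
theorem reducedForm_apply (S : StructuralEquations ι) (u : ι → ℝ) (i : ι) :
    S.reducedForm u i = S.f i (S.reducedForm u) (u i) := by
  classical
  unfold reducedForm
  rw [WellFounded.fix_eq]
  apply S.f_parents
  intro j hj
  simp [hj]

/-- `F u` is the only solution of the structural equations. -/
theorem eq_reducedForm (S : StructuralEquations ι) {u v : ι → ℝ}
    (hv : ∀ i, v i = S.f i v (u i)) : v = S.reducedForm u := by
  funext i
  induction i using S.wellFounded_edge.induction with
  | _ i ih =>
    rw [hv, reducedForm_apply]
    exact S.f_parents i _ _ _ fun j hj => ih j hj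

end StructuralEquations

namespace StructuralEquations

variable {ι : Type*} [DecidableEq ι]

/-- The hard intervention `do(V_I := τ)`. -/
def hardIntervention (S : StructuralEquations ι) (I : Finset ι) (τ : I → ℝ) :
    StructuralEquations ι where
  edge j i := S.edge j i ∧ i ∉ I
  acyclic i h := S.acyclic i (Relation.TransGen.mono (p := S.edge) (fun _ _ h => h.1) _ _ h)
  f i v u := if h : i ∈ I then τ ⟨i, h⟩ else S.f i v u
  f_parents i v v' u h := by
    by_cases hi : i ∈ I
    · simp [hi]
    · simpa [hi] using S.f_parents i v v' u fun j hj => h j ⟨hj, hi⟩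

/-- The parent-free sensitive attribute model: every sensitive variable `i ∈ I` becomes its own
exogenous variable. -/
def parentFree (S : StructuralEquations ι) (I : Finset ι) : StructuralEquations ι where
  edge j i := S.edge j i ∧ i ∉ I
  acyclic i h := S.acyclic i (Relation.TransGen.mono (p := S.edge) (fun _ _ h => h.1) _ _ h)
  f i v u := if i ∈ I then u else S.f i v u
  f_parents i v v' u h := by
    by_cases hi : i ∈ I
    · simp [hi]
    · simpa [hi] using S.f_parents i v v' u fun j hj => h j ⟨hj, hi⟩

end StructuralEquations

/-- An additive noise model `V i := f i (V restricted to the parents of i) + U i` over an acyclic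
directed graph, with mutually independent exogenous variables `U i` of law `noise i` (so that the
law of `U` is the product of the `noise i`). -/
structure AdditiveNoiseModel (ι : Type*) where
  edge : ι → ι → Prop
  acyclic : ∀ i, ¬ Relation.TransGen edge i i
  f : ι → (ι → ℝ) → ℝ
  f_parents : ∀ i v v', (∀ j, edge j i → v j = v' j) → f i v = f i v'
  noise : ι → ProbabilityMeasure ℝ

namespace AdditiveNoiseModel

variable {ι : Type*} [Fintype ι] [DecidableEq ι]

/-- A linear structural causal model is an additive noise model with linear `f i`. -/
def IsLinear (S : AdditiveNoiseModel ι) : Prop :=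
  ∀ i, IsLinearMap ℝ (S.f i)

/-- The structural equations of the model. -/
def toEquations (S : AdditiveNoiseModel ι) : StructuralEquations ι where
  edge := S.edge
  acyclic := S.acyclic
  f i v u := S.f i v + u
  f_parents i v v' u h := by rw [S.f_parents i v v' h]

/-- The inverse `F⁻¹ = id - f` of the reduced-form map. -/
def exogenous (S : AdditiveNoiseModel ι) (v : ι → ℝ) : ι → ℝ :=
  fun i => v i - S.f i v

/-- The twin of `v` at the sensitive level `a`: the counterfactual `F^{do(V_I := a)} (F⁻¹ v)`. -/
noncomputable def twin (S : AdditiveNoiseModel ι) (I : Finset ι) (v : ι → ℝ) (a : I → ℝ) :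
    ι → ℝ :=
  (S.toEquations.hardIntervention I a).reducedForm (S.exogenous v)

/-- The map `g` to the semi-latent space: `v i` on the sensitive indices, `(F⁻¹ v) i` on the
others. -/
def semiLatent (S : AdditiveNoiseModel ι) (I : Finset ι) (v : ι → ℝ) : ι → ℝ :=
  fun i => if i ∈ I then v i else S.exogenous v i

/-- The inverse `g⁻¹`: the reduced form of the parent-free sensitive attribute model. -/
noncomputable def semiLatentInv (S : AdditiveNoiseModel ι) (I : Finset ι) (u : ι → ℝ) : ι → ℝ :=
  (S.toEquations.parentFree I).reducedForm u

theorem semiLatent_semiLatentInv (S : AdditiveNoiseModel ι) (I : Finset ι) (u : ι → ℝ) :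
    S.semiLatent I (S.semiLatentInv I u) = u := by
  funext i
  have h := (S.toEquations.parentFree I).reducedForm_apply u i
  by_cases hi : i ∈ I
  · simpa [semiLatent, semiLatentInv, hi, StructuralEquations.parentFree] using h
  · simp only [StructuralEquations.parentFree, hi, if_false, toEquations] at h
    simp only [semiLatent, exogenous, hi, if_false, semiLatentInv, StructuralEquations.parentFree,
      toEquations]
    linarith

theorem semiLatentInv_semiLatent (S : AdditiveNoiseModel ι) (I : Finset ι) (v : ι → ℝ) :
    S.semiLatentInv I (S.semiLatent I v) = v := by
  refine (StructuralEquations.eq_reducedForm _ fun i => ?_).symm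
  by_cases hi : i ∈ I <;>
    simp [StructuralEquations.parentFree, toEquations, semiLatent, exogenous, hi]

/-- The matrix `M` of `g⁻¹`: its columns are the images of the standard basis vectors. -/
noncomputable def semiLatentMatrix (S : AdditiveNoiseModel ι) (I : Finset ι) : Matrix ι ι ℝ :=
  Matrix.of fun i j => S.semiLatentInv I (Pi.single j 1) i

/-- For a linear model `M` represents `g⁻¹`. -/
theorem semiLatentMatrix_mulVec (S : AdditiveNoiseModel ι) (hS : S.IsLinear) (I : Finset ι)
    (u : ι → ℝ) : S.semiLatentMatrix I *ᵥ u = S.semiLatentInv I u := by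
  refine StructuralEquations.eq_reducedForm _ fun i => ?_
  have key : S.semiLatentMatrix I *ᵥ u = ∑ j, u j • S.semiLatentInv I (Pi.single j 1) := by
    funext k
    simp [Matrix.mulVec, dotProduct, semiLatentMatrix, mul_comm]
  have h : ∀ j, S.semiLatentInv I (Pi.single j 1) i = _ := fun j =>
    (S.toEquations.parentFree I).reducedForm_apply (Pi.single j 1) i
  by_cases hi : i ∈ I
  · rw [key]
    simp only [StructuralEquations.parentFree, hi, if_true] at h ⊢
    simp [h, Pi.single_apply]
  · have hlin : ∀ w : ι → ι → ℝ, S.f i (∑ j, u j • w j) = ∑ j, u j * S.f i (w j) := fun w => by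
      have e := map_sum ((hS i).mk' (S.f i)) (fun j => u j • w j) Finset.univ
      simp only [map_smul, smul_eq_mul] at e
      exact e
    simp only [StructuralEquations.parentFree, toEquations, hi, if_false] at h ⊢
    rw [key, hlin, Finset.sum_apply]
    simp only [Pi.smul_apply, smul_eq_mul, h, mul_add, Finset.sum_add_distrib]
    simp only [Pi.single_apply, mul_ite, mul_one, mul_zero, Finset.sum_ite_eq, Finset.mem_univ,
      if_true]
    rfl

end AdditiveNoiseModel

/-! ### Sensitive and non-sensitive parts, dual norm -/

section Parts

variable {ι : Type*}

/-- The projection `P_𝒜` onto the sensitive coordinates. -/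
def sensitivePart (I : Finset ι) (v : ι → ℝ) : I → ℝ := fun i => v i

/-- The projection `P_𝒳` onto the non-sensitive coordinates. -/
def nonsensitivePart (I : Finset ι) (v : ι → ℝ) : {i // i ∉ I} → ℝ := fun i => v i

/-- The feature space `𝒱`: the vectors whose sensitive part is one of the admissible levels `𝒜`,
that is, `g⁻¹ (𝒜 × 𝒳)`. -/
def featureSpace (I : Finset ι) (A : Set (I → ℝ)) : Set (ι → ℝ) := {v | sensitivePart I v ∈ A}

/-- The dual norm `‖x‖_* = sup {⟨x, x'⟩ | ‖x'‖ ≤ 1}` of a norm `ν`. -/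
noncomputable def dualNorm {κ : Type*} [Fintype κ] (ν : Seminorm ℝ (κ → ℝ)) (x : κ → ℝ) : ℝ :=
  sSup {r | ∃ x', ν x' ≤ 1 ∧ r = x ⬝ᵥ x'}

end Parts

/-! ### Optimal transport -/

section Transport

variable {Z : Type*} [MeasurableSpace Z]

/-- The optimal transport cost `W_{c,p}`. -/
noncomputable def transportCost (c : Z → Z → ℝ≥0∞) (p : ℝ) (P Q : ProbabilityMeasure Z) : ℝ≥0∞ :=
  ⨅ π : {π : ProbabilityMeasure (Z × Z) //
      (π : Measure (Z × Z)).map Prod.fst = P ∧ (π : Measure (Z × Z)).map Prod.snd = Q},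
    (∫⁻ z, c z.1 z.2 ^ p ∂(π.1 : Measure (Z × Z))) ^ (1 / p)

/-- The risk `E_P[L]` of a non-negative loss `L`. -/
noncomputable def risk (L : Z → ℝ) (P : ProbabilityMeasure Z) : ℝ≥0∞ :=
  ∫⁻ z, ENNReal.ofReal (L z) ∂(P : Measure Z)

/-- The worst-case loss: the supremum of `E_Q[L]` over the ambiguity set `W_{c,p}(P, Q) ≤ δ`. -/
noncomputable def worstCaseRisk (c : Z → Z → ℝ≥0∞) (p δ : ℝ) (L : Z → ℝ)
    (P : ProbabilityMeasure Z) : ℝ≥0∞ :=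
  ⨆ Q : {Q : ProbabilityMeasure Z // transportCost c p P Q ≤ ENNReal.ofReal δ}, risk L Q.1

/-- The empirical distribution `(1 / N) ∑ δ_{z k}` of `N ≥ 1` observations. -/
noncomputable def empirical {N : ℕ} [NeZero N] (z : Fin N → Z) : ProbabilityMeasure Z :=
  ⟨(N : ℝ≥0∞)⁻¹ • ∑ k, Measure.dirac (z k), ⟨by
    simp [ENNReal.inv_mul_cancel, NeZero.ne N]⟩⟩

end Transport

/-! ### The causally fair cost and the losses -/

section Fair

variable {ι : Type*} [Fintype ι] [DecidableEq ι]

/-- The cost `c((v, y), (v', y')) = ‖P_𝒳 (g v) - P_𝒳 (g v')‖ + ∞ * |y - y'|` on `𝒵 = 𝒱 × ℝ`. -/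
noncomputable def fairCost (S : AdditiveNoiseModel ι) (I : Finset ι) (A : Set (I → ℝ))
    (ν : Seminorm ℝ ({i // i ∉ I} → ℝ)) (z z' : featureSpace I A × ℝ) : ℝ≥0∞ :=
  ENNReal.ofReal (ν (nonsensitivePart I (S.semiLatent I z.1) -
    nonsensitivePart I (S.semiLatent I z'.1))) + ⊤ * ENNReal.ofReal |z.2 - z'.2|

/-- The counterfactual risk: the expectation of the supremum of the loss over all twins. -/
noncomputable def counterfactualRisk (S : AdditiveNoiseModel ι) (I : Finset ι) (A : Set (I → ℝ))
    (L : (ι → ℝ) → ℝ → ℝ) (P : ProbabilityMeasure (featureSpace I A × ℝ)) : ℝ≥0∞ :=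
  ∫⁻ z, ⨆ a : A, ENNReal.ofReal (L (S.twin I z.1 a) z.2)
    ∂(P : Measure (featureSpace I A × ℝ))

/-- The functions `|t|`, `max(0, t)`, `|t - τ|` and `max(0, t - τ)`. -/
inductive IsBaseLoss : (ℝ → ℝ) → Prop
  | abs : IsBaseLoss fun t => |t|
  | pos : IsBaseLoss fun t => max 0 t
  | absShift (τ : ℝ) : IsBaseLoss fun t => |t - τ|
  | posShift (τ : ℝ) : IsBaseLoss fun t => max 0 (t - τ)

/-- The two types of learning problems. -/
inductive LearningTask
  | regression
  | classification

/-- The losses `h(y - ⟨θ, v⟩)` (regression) and `h(y * ⟨θ, v⟩)` (classification). -/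
def linearLoss (T : LearningTask) (h : ℝ → ℝ) (θ v : ι → ℝ) (y : ℝ) : ℝ :=
  match T with
  | .regression => h (y - θ ⬝ᵥ v)
  | .classification => h (y * (θ ⬝ᵥ v))

end Fair

/-! ### Dual norm -/

/-! In semi-latent coordinates write `g v = (a, x)`. Passing to a twin replaces `a` and keeps `x`
(`twin_eq_ofParts`), and with `(w, u)` the two parts of `Mᵀ θ` the loss is `h (offset + slope * (⟨w,
a⟩ + ⟨u, x⟩))`, where `|slope| = 1` at the observed labels. The cost ignores `a`, forbids a change
of label, and charges `ν` for a move of `x`. So transport switches to the worst twin for free and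
spends the budget `δ` on `x`, which gives `R_δ^(1/p) = (R^cf)^(1/p) + δ ‖u‖_*`
(`worstCaseRisk_fairCost_eq`).

Upper bound: `h` is 1-Lipschitz, so the loss at the target of a transport is at most the supremum
over the twins of the source plus `‖u‖_*` times the distance; Minkowski's inequality in `L^p` of the
plan finishes (`worstCaseRisk_le`).

Lower bound: fix one level per observation and move the twins along a vector `d` of the unit ball
attaining `‖u‖_*`. The problem becomes one-dimensional, with losses `h (t k + s * D) ^ p` at cost at
most `|s|`. Shifts proportional to the losses give equality in Minkowski
(`le_worstCaseRisk_of_pos`); if all losses vanish, a small mass is sent far away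
(`ofReal_mul_rpow_le_worstCaseRisk`). The supremum over the choices of levels is the counterfactual
risk.

The remaining claims evaluate `R^cf`: for `w = 0` all twins have the same loss, so it is the plain
risk; for `w ≠ 0` and `h` unbounded along every nonzero functional on the levels it is infinite. -/

theorem Seminorm.continuous_of_fintype {κ : Type*} [Fintype κ] (ν : Seminorm ℝ (κ → ℝ)) :
    Continuous ν :=
  continuousOn_univ.1 (ν.convexOn.continuousOn isOpen_univ)

/-- A definite continuous seminorm has a positive minimum on the compact unit sphere; `C` is its
inverse. This makes the unit ball of `ν` bounded, hence compact. -/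
theorem exists_norm_le_mul_seminorm {κ : Type*} [Fintype κ] (ν : Seminorm ℝ (κ → ℝ))
    (hν : ∀ x, ν x = 0 → x = 0) : ∃ C : ℝ, ∀ x, ‖x‖ ≤ C * ν x := by
  by_cases hs : (Metric.sphere (0 : κ → ℝ) 1).Nonempty
  · obtain ⟨x₀, hx₀, hmin⟩ := (isCompact_sphere (0 : κ → ℝ) 1).exists_isMinOn hs
      ν.continuous_of_fintype.continuousOn
    have hx₀' : ‖x₀‖ = 1 := by simpa using hx₀
    have hpos : 0 < ν x₀ := lt_of_le_of_ne (apply_nonneg ν _) fun h => by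
      rw [hν x₀ h.symm] at hx₀'; simp at hx₀'
    refine ⟨(ν x₀)⁻¹, fun x => ?_⟩
    rcases eq_or_ne x 0 with rfl | hx
    · simp
    have hn : 0 < ‖x‖ := norm_pos_iff.2 hx
    have h1 : ν x₀ ≤ ν (‖x‖⁻¹ • x) := hmin (by simp [norm_smul, hn.ne'])
    rw [map_smul_eq_mul, norm_inv, norm_norm] at h1
    rw [le_inv_mul_iff₀ hpos]
    rwa [le_inv_mul_iff₀ hn, mul_comm] at h1
  · refine ⟨0, fun x => ?_⟩
    by_cases hx : x = 0
    · simp [hx]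
    · exact absurd ⟨‖x‖⁻¹ • x, by simp [norm_smul, hx]⟩ hs

/-- The dual norm is attained on the unit ball. -/
theorem exists_dotProduct_eq_dualNorm {κ : Type*} [Fintype κ] (ν : Seminorm ℝ (κ → ℝ))
    (hν : ∀ x, ν x = 0 → x = 0) (w : κ → ℝ) :
    ∃ d, ν d ≤ 1 ∧ w ⬝ᵥ d = dualNorm ν w ∧ ∀ x, ν x ≤ 1 → w ⬝ᵥ x ≤ dualNorm ν w := by
  obtain ⟨C, hC⟩ := exists_norm_le_mul_seminorm ν hν
  have hcomp : IsCompact {x | ν x ≤ 1} := by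
    refine Metric.isCompact_of_isClosed_isBounded
      (isClosed_le ν.continuous_of_fintype continuous_const)
      ((Metric.isBounded_closedBall (x := (0 : κ → ℝ)) (r := |C|)).subset fun x hx => ?_)
    have hx : ν x ≤ 1 := hx
    rw [mem_closedBall_zero_iff]
    calc ‖x‖ ≤ C * ν x := hC x
      _ ≤ |C| * 1 := mul_le_mul (le_abs_self C) hx (apply_nonneg ν x) (abs_nonneg C)
      _ = |C| := mul_one _
  obtain ⟨d, hd, hmax⟩ := hcomp.exists_isMaxOn (f := fun x => w ⬝ᵥ x) ⟨0, by simp⟩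
    (by unfold dotProduct; fun_prop)
  have hG : IsGreatest {r | ∃ x', ν x' ≤ 1 ∧ r = w ⬝ᵥ x'} (w ⬝ᵥ d) :=
    ⟨⟨d, hd, rfl⟩, by rintro _ ⟨x, hx, rfl⟩; exact hmax hx⟩
  have he : dualNorm ν w = w ⬝ᵥ d := hG.csSup_eq
  exact ⟨d, hd, he.symm, fun x hx => he ▸ hmax hx⟩

theorem dualNorm_nonneg {κ : Type*} [Fintype κ] (ν : Seminorm ℝ (κ → ℝ))
    (hν : ∀ x, ν x = 0 → x = 0) (w : κ → ℝ) : 0 ≤ dualNorm ν w := by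
  obtain ⟨-, -, -, h⟩ := exists_dotProduct_eq_dualNorm ν hν w
  simpa using h 0 (by simp)

theorem abs_dotProduct_le_dualNorm_mul {κ : Type*} [Fintype κ] (ν : Seminorm ℝ (κ → ℝ))
    (hν : ∀ x, ν x = 0 → x = 0) (w x : κ → ℝ) : |w ⬝ᵥ x| ≤ dualNorm ν w * ν x := by
  obtain ⟨-, -, -, h⟩ := exists_dotProduct_eq_dualNorm ν hν w
  have key : ∀ x, w ⬝ᵥ x ≤ dualNorm ν w * ν x := fun x => by
    rcases (apply_nonneg ν x).eq_or_lt with h0 | h0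
    · rw [hν x h0.symm]; simp
    · have := h ((ν x)⁻¹ • x) (by
        rw [map_smul_eq_mul, norm_inv, Real.norm_of_nonneg h0.le, inv_mul_cancel₀ h0.ne'])
      rw [dotProduct_smul, smul_eq_mul, inv_mul_le_iff₀ h0] at this
      linarith
  refine abs_le'.2 ⟨key x, ?_⟩
  simpa using key (-x)

/-! ### Base losses -/

namespace IsBaseLoss

variable {h : ℝ → ℝ}

theorem eq_shift (hh : IsBaseLoss h) :
    ∃ τ, h = (fun t => |t - τ|) ∨ h = fun t => max 0 (t - τ) := by
  cases hh with
  | abs => exact ⟨0, by simp⟩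
  | pos => exact ⟨0, by simp⟩
  | absShift τ => exact ⟨τ, Or.inl rfl⟩
  | posShift τ => exact ⟨τ, Or.inr rfl⟩

theorem nonneg (hh : IsBaseLoss h) (t : ℝ) : 0 ≤ h t := by
  obtain ⟨τ, rfl | rfl⟩ := hh.eq_shift
  · exact abs_nonneg _
  · exact le_max_left _ _

theorem le_add_abs_sub (hh : IsBaseLoss h) (s t : ℝ) : h s ≤ h t + |s - t| := by
  obtain ⟨τ, rfl | rfl⟩ := hh.eq_shift
  · grind
  · grind

theorem continuous (hh : IsBaseLoss h) : Continuous h := by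
  obtain ⟨τ, rfl | rfl⟩ := hh.eq_shift <;> fun_prop

/-- A positive base loss has slope one in one of the two directions. -/
theorem exists_direction (hh : IsBaseLoss h) {t : ℝ} (ht : 0 < h t) :
    ∃ ε : ℝ, |ε| = 1 ∧ ∀ s, 0 ≤ s → h t + s ≤ h (t + ε * s) := by
  obtain ⟨τ, rfl | rfl⟩ := hh.eq_shift
  · rcases le_total τ t with h' | h'
    · exact ⟨1, by simp, fun s hs => by grind⟩
    · exact ⟨-1, by simp, fun s hs => by grind⟩
  · refine ⟨1, by simp, fun s hs => ?_⟩
    have : 0 < t - τ := by simpa using ht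
    grind

/-- Unlike in `exists_direction`, `h t` may vanish: to the right both shapes eventually have slope
one, and `C` absorbs the distance from `t` to the kink `τ`. -/
theorem exists_sub_le (hh : IsBaseLoss h) (t : ℝ) : ∃ C, 0 ≤ C ∧ ∀ s, s - C ≤ h (t + s) := by
  obtain ⟨τ, rfl | rfl⟩ := hh.eq_shift
  · exact ⟨|t - τ|, abs_nonneg _, fun s => by grind⟩
  · exact ⟨|t - τ|, abs_nonneg _, fun s => by grind⟩

end IsBaseLoss

/-! ### Semi-latent coordinates -/

namespace AdditiveNoiseModel

variable {ι : Type*} [DecidableEq ι]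

/-- The vector with sensitive part `a` and non-sensitive part `x`. -/
def glueParts (I : Finset ι) (a : I → ℝ) (x : {i // i ∉ I} → ℝ) : ι → ℝ :=
  fun i => if hi : i ∈ I then a ⟨i, hi⟩ else x ⟨i, hi⟩

theorem sensitivePart_glueParts (I : Finset ι) (a : I → ℝ) (x : {i // i ∉ I} → ℝ) :
    sensitivePart I (glueParts I a x) = a := by
  funext i; simp [sensitivePart, glueParts]

theorem nonsensitivePart_glueParts (I : Finset ι) (a : I → ℝ) (x : {i // i ∉ I} → ℝ) :
    nonsensitivePart I (glueParts I a x) = x := by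
  funext i; simp [nonsensitivePart, glueParts, i.2]

theorem glueParts_parts (I : Finset ι) (u : ι → ℝ) :
    glueParts I (sensitivePart I u) (nonsensitivePart I u) = u := by
  funext i; simp [sensitivePart, nonsensitivePart, glueParts]

variable (S : AdditiveNoiseModel ι) (I : Finset ι)

theorem sensitivePart_semiLatent (v : ι → ℝ) :
    sensitivePart I (S.semiLatent I v) = sensitivePart I v := by
  funext i; simp [sensitivePart, semiLatent]

variable [Fintype ι]

/-- The feature vector with semi-latent coordinates `(a, x)`. -/
noncomputable def ofParts (a : I → ℝ) (x : {i // i ∉ I} → ℝ) : ι → ℝ :=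
  S.semiLatentInv I (glueParts I a x)

theorem sensitivePart_ofParts (a : I → ℝ) (x : {i // i ∉ I} → ℝ) :
    sensitivePart I (S.ofParts I a x) = a := by
  rw [← sensitivePart_semiLatent S I, ofParts, semiLatent_semiLatentInv, sensitivePart_glueParts]

theorem nonsensitivePart_semiLatent_ofParts (a : I → ℝ) (x : {i // i ∉ I} → ℝ) :
    nonsensitivePart I (S.semiLatent I (S.ofParts I a x)) = x := by
  rw [ofParts, semiLatent_semiLatentInv, nonsensitivePart_glueParts]

theorem ofParts_parts (v : ι → ℝ) :
    S.ofParts I (sensitivePart I v) (nonsensitivePart I (S.semiLatent I v)) = v := by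
  rw [← sensitivePart_semiLatent S I, ofParts, glueParts_parts, semiLatentInv_semiLatent]

/-- Twins replace the sensitive part and keep the non-sensitive semi-latent part. -/
theorem twin_eq_ofParts (v : ι → ℝ) (a : I → ℝ) :
    S.twin I v a = S.ofParts I a (nonsensitivePart I (S.semiLatent I v)) := by
  refine StructuralEquations.eq_reducedForm _ fun i => ?_
  have e := (S.toEquations.hardIntervention I a).reducedForm_apply (S.exogenous v) i
  change S.twin I v a i = _ at e
  rw [e]
  by_cases hi : i ∈ I
  · simp [StructuralEquations.parentFree, StructuralEquations.hardIntervention, hi, glueParts]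
  · simp only [StructuralEquations.parentFree, StructuralEquations.hardIntervention, hi, glueParts,
      nonsensitivePart, semiLatent]
    rfl

/-- `⟨θ, M u⟩ = ⟨Mᵀ θ, u⟩`, with the sum split over the sensitive and the other indices. -/
theorem dotProduct_ofParts (hS : S.IsLinear) (θ : ι → ℝ) (a : I → ℝ) (x : {i // i ∉ I} → ℝ) :
    θ ⬝ᵥ S.ofParts I a x = sensitivePart I ((S.semiLatentMatrix I)ᵀ *ᵥ θ) ⬝ᵥ a +
      nonsensitivePart I ((S.semiLatentMatrix I)ᵀ *ᵥ θ) ⬝ᵥ x := by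
  rw [ofParts, ← S.semiLatentMatrix_mulVec hS, Matrix.dotProduct_mulVec, ← Matrix.mulVec_transpose]
  generalize (S.semiLatentMatrix I)ᵀ *ᵥ θ = w
  simp only [dotProduct]
  rw [← Fintype.sum_subtype_add_sum_subtype (fun i => i ∈ I)]
  congr 1
  · refine Finset.sum_congr (by ext; simp) fun i _ => ?_
    simp [glueParts, sensitivePart]
  · refine Finset.sum_congr rfl fun i _ => ?_
    simp [glueParts, nonsensitivePart, i.2]

theorem continuous_nonsensitivePart_semiLatent (hS : S.IsLinear) :
    Continuous fun v => nonsensitivePart I (S.semiLatent I v) := by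
  refine continuous_pi fun i => ?_
  have : Continuous (S.f i) := ((hS i).mk' (S.f i)).continuous_of_finiteDimensional
  simp only [nonsensitivePart, semiLatent, i.2, if_false, exogenous]
  fun_prop

end AdditiveNoiseModel

/-! ### Empirical distributions and discrete couplings -/

section Discrete

variable {Z : Type*} [MeasurableSpace Z]

theorem lintegral_empirical [MeasurableSingletonClass Z] {N : ℕ} [NeZero N]
    (z : Fin N → Z) (f : Z → ℝ≥0∞) :
    ∫⁻ x, f x ∂(empirical z : Measure Z) = (N : ℝ≥0∞)⁻¹ * ∑ k, f (z k) := by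
  simp [empirical, lintegral_finsetSum_measure]

theorem ae_empirical [MeasurableSingletonClass Z] {N : ℕ} [NeZero N]
    (z : Fin N → Z) {q : Z → Prop} (hq : ∀ k, q (z k)) :
    ∀ᵐ x ∂(empirical z : Measure Z), q x := by
  refine Measure.ae_smul_measure ?_ _
  rw [ae_finsetSum_measure_iff]
  intro k _
  rw [ae_dirac_eq]
  exact hq k

/-- A finitely supported transport plan of cost at most `δ` bounds the worst-case risk below. -/
theorem sum_le_worstCaseRisk [MeasurableSingletonClass Z] {c : Z → Z → ℝ≥0∞} {p δ : ℝ}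
    (hp : 0 < p) {L : Z → ℝ}
    {P : ProbabilityMeasure Z} {J : Type*} [Fintype J] (ω : J → ℝ≥0∞) (x x' : J → Z)
    (hω : ∑ j, ω j = 1) (hP : ∑ j, ω j • Measure.dirac (x j) = (P : Measure Z))
    (hc : ∑ j, ω j * c (x j) (x' j) ^ p ≤ ENNReal.ofReal δ ^ p) :
    ∑ j, ω j * ENNReal.ofReal (L (x' j)) ≤ worstCaseRisk c p δ L P := by
  let Q : ProbabilityMeasure Z := ⟨∑ j, ω j • Measure.dirac (x' j), ⟨by simp [hω]⟩⟩
  let π : ProbabilityMeasure (Z × Z) :=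
    ⟨∑ j, ω j • Measure.dirac (x j, x' j), ⟨by simp [hω]⟩⟩
  have hmap : ∀ g : Z × Z → Z, Measurable g →
      (π : Measure (Z × Z)).map g = ∑ j, ω j • Measure.dirac (g (x j, x' j)) := fun g hg => by
    change (∑ j, ω j • Measure.dirac (x j, x' j)).map g = _
    rw [← Measure.mapₗ_apply_of_measurable hg, map_sum]
    refine Finset.sum_congr rfl fun j _ => ?_
    rw [map_smul, Measure.mapₗ_apply_of_measurable hg, Measure.map_dirac' hg]
  have hW : transportCost c p P Q ≤ ENNReal.ofReal δ := by
    refine (iInf_le _ ⟨π, by rw [hmap _ measurable_fst]; exact hP,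
      by rw [hmap _ measurable_snd]; rfl⟩).trans ?_
    rw [one_div, ENNReal.rpow_inv_le_iff hp]
    refine le_of_eq_of_le ?_ hc
    change ∫⁻ z, _ ∂(∑ j, ω j • Measure.dirac (x j, x' j)) = _
    simp [lintegral_finsetSum_measure]
  refine le_of_eq_of_le ?_ (le_iSup (fun Q : {Q : ProbabilityMeasure Z //
    transportCost c p P Q ≤ ENNReal.ofReal δ} => risk L Q.1) ⟨Q, hW⟩)
  change _ = ∫⁻ z, _ ∂(∑ j, ω j • Measure.dirac (x' j))
  simp [lintegral_finsetSum_measure]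

/-- Minkowski's inequality bounds the worst-case risk, if along the transport the `p`-th root of
the loss grows at most linearly with the cost. -/
theorem worstCaseRisk_le {c : Z → Z → ℝ≥0∞} {p δ : ℝ} (hp : 1 ≤ p) {L : Z → ℝ}
    {P : ProbabilityMeasure Z} {F : Z → ℝ≥0∞} {G : Z → Z → ℝ≥0∞} (K : ℝ)
    (hL : Measurable L) (hF : Measurable F) (hG : Measurable fun z : Z × Z => G z.1 z.2)
    (hGc : ∀ z z', G z z' ≤ c z z') {q : Z → Prop} (hq : ∀ᵐ z ∂(P : Measure Z), q z)
    (hcm : Measurable fun z : Z × Z => c z.1 z.2)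
    (hbound : ∀ z z', q z → c z z' ≠ ⊤ →
      ENNReal.ofReal (L z') ≤ (F z ^ (1 / p) + ENNReal.ofReal K * G z z') ^ p) :
    worstCaseRisk c p δ L P ≤
      ((∫⁻ z, F z ∂(P : Measure Z)) ^ (1 / p) + ENNReal.ofReal K * ENNReal.ofReal δ) ^ p := by
  have hp0 : 0 < p := zero_lt_one.trans_le hp
  refine iSup_le fun ⟨Q, hQ⟩ => ?_
  rw [← ENNReal.rpow_inv_le_iff hp0, ← one_div]
  -- The infimum over couplings need not be attained, so a plan of cost below `δ + η` is used and
  -- `η` tends to `0` at the end.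
  have key : ∀ η : ℝ, 0 < η → risk L Q ^ (1 / p) ≤ (∫⁻ z, F z ∂(P : Measure Z)) ^ (1 / p) +
      ENNReal.ofReal K * (ENNReal.ofReal δ + ENNReal.ofReal η) := by
    intro η hη
    have hlt : transportCost c p P Q < ENNReal.ofReal δ + ENNReal.ofReal η :=
      hQ.trans_lt (ENNReal.lt_add_right ENNReal.ofReal_ne_top (by simpa using hη))
    obtain ⟨⟨π, hπ₁, hπ₂⟩, hπ⟩ := iInf_lt_iff.1 hlt
    -- A plan of finite total cost avoids the forbidden moves almost surely, so `hbound` is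
    -- available almost everywhere.
    have hfin : ∀ᵐ z ∂(π : Measure (Z × Z)), c z.1 z.2 ≠ ⊤ := by
      have h1 : (∫⁻ z, c z.1 z.2 ^ p ∂(π : Measure (Z × Z))) ≠ ⊤ := fun h => by
        simp only [h] at hπ
        rw [ENNReal.top_rpow_of_pos (by positivity)] at hπ
        exact not_top_lt hπ
      filter_upwards [ae_lt_top (hcm.pow_const p) h1] with z hz h
      rw [h, ENNReal.top_rpow_of_pos hp0] at hz
      exact lt_irrefl _ hz
    have hq' : ∀ᵐ z ∂(π : Measure (Z × Z)), q z.1 :=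
      ae_of_ae_map measurable_fst.aemeasurable (by rw [hπ₁]; exact hq)
    have hR : risk L Q = ∫⁻ z, ENNReal.ofReal (L z.2) ∂(π : Measure (Z × Z)) := by
      rw [risk, ← hπ₂, lintegral_map (by fun_prop) measurable_snd]
    have hFπ : ∫⁻ z, F z ∂(P : Measure Z) =
        ∫⁻ z, (F z.1 ^ (1 / p)) ^ p ∂(π : Measure (Z × Z)) := by
      rw [← hπ₁, lintegral_map hF measurable_fst]
      simp_rw [one_div, ENNReal.rpow_inv_rpow hp0.ne']
    calc risk L Q ^ (1 / p)
        ≤ (∫⁻ z, ((fun z : Z × Z => F z.1 ^ (1 / p)) +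
            fun z : Z × Z => ENNReal.ofReal K * G z.1 z.2) z ^ p ∂(π : Measure (Z × Z)))
              ^ (1 / p) := by
          rw [hR]
          refine ENNReal.rpow_le_rpow (lintegral_mono_ae ?_) (by positivity)
          filter_upwards [hfin, hq'] with z h1 h2 using hbound _ _ h2 h1
      _ ≤ (∫⁻ z, (F z.1 ^ (1 / p)) ^ p ∂(π : Measure (Z × Z))) ^ (1 / p) +
          (∫⁻ z, (ENNReal.ofReal K * G z.1 z.2) ^ p ∂(π : Measure (Z × Z))) ^ (1 / p) :=
        ENNReal.lintegral_Lp_add_le ((hF.comp measurable_fst).pow_const _).aemeasurable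
          (hG.const_mul _).aemeasurable hp
      _ ≤ _ := by
          rw [← hFπ]
          gcongr
          simp_rw [ENNReal.mul_rpow_of_nonneg _ _ hp0.le]
          rw [lintegral_const_mul _ (hG.pow_const p), ENNReal.mul_rpow_of_nonneg _ _ (by positivity),
            one_div, ENNReal.rpow_rpow_inv hp0.ne', ← one_div]
          gcongr
          refine (ENNReal.rpow_le_rpow (lintegral_mono fun z => ?_) (by positivity)).trans hπ.le
          exact ENNReal.rpow_le_rpow (hGc _ _) hp0.le
  have hlim : Filter.Tendsto (fun η : ℝ => (∫⁻ z, F z ∂(P : Measure Z)) ^ (1 / p) +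
      ENNReal.ofReal K * (ENNReal.ofReal δ + ENNReal.ofReal η)) (nhdsWithin 0 (Set.Ioi 0))
      (nhds ((∫⁻ z, F z ∂(P : Measure Z)) ^ (1 / p) + ENNReal.ofReal K * ENNReal.ofReal δ)) := by
    have h0 : Filter.Tendsto (fun η : ℝ => ENNReal.ofReal δ + ENNReal.ofReal η)
        (nhdsWithin 0 (Set.Ioi 0)) (nhds (ENNReal.ofReal δ)) := by
      have : Continuous fun η : ℝ => ENNReal.ofReal δ + ENNReal.ofReal η :=
        ENNReal.continuous_ofReal.const_add _
      simpa using (this.tendsto 0).mono_left nhdsWithin_le_nhds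
    exact (ENNReal.Tendsto.const_mul h0 (Or.inr ENNReal.ofReal_ne_top)).const_add _
  exact ge_of_tendsto hlim (Filter.eventually_of_mem self_mem_nhdsWithin key)

end Discrete

/-! ### Lower bound for linearly growing losses -/

section Growth

variable {Z : Type*} [MeasurableSpace Z] {N : ℕ} [NeZero N]

theorem sum_inv_natCast_eq_one : ∑ _k : Fin N, (N : ℝ≥0∞)⁻¹ = 1 := by
  simp [ENNReal.mul_inv_cancel, NeZero.ne N]

theorem sum_smul_dirac_eq_empirical (z : Fin N → Z) :
    ∑ k, (N : ℝ≥0∞)⁻¹ • Measure.dirac (z k) = (empirical z : Measure Z) := by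
  rw [← Finset.smul_sum]; rfl

theorem inv_mul_sum_ofReal (r : Fin N → ℝ) (hr : ∀ k, 0 ≤ r k) :
    ∑ k, (N : ℝ≥0∞)⁻¹ * ENNReal.ofReal (r k) = ENNReal.ofReal ((N : ℝ)⁻¹ * ∑ k, r k) := by
  have hN : (0 : ℝ) < N := by exact_mod_cast Nat.pos_of_ne_zero (NeZero.ne N)
  rw [← Finset.mul_sum, ENNReal.ofReal_mul (by positivity), ENNReal.ofReal_inv_of_pos hN,
    ENNReal.ofReal_natCast, ENNReal.ofReal_sum_of_nonneg fun k _ => hr k]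

variable [MeasurableSingletonClass Z] {c : Z → Z → ℝ≥0∞} {p δ D : ℝ} {L : Z → ℝ} {h : ℝ → ℝ}
  {z : Fin N → Z} {t : Fin N → ℝ}
  {q : Fin N → ℝ → Z}

/-- If the observations have positive loss, shifts proportional to the losses are optimal. -/
theorem le_worstCaseRisk_of_pos (hh : IsBaseLoss h) (hp : 1 ≤ p) (hδ : 0 ≤ δ) (hD : 0 ≤ D)
    (hc : ∀ k s, c (z k) (q k s) ≤ ENNReal.ofReal |s|) (hL : ∀ k s, L (q k s) = h (t k + s * D) ^ p)
    (hm : 0 < (N : ℝ)⁻¹ * ∑ k, h (t k) ^ p) :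
    ENNReal.ofReal ((((N : ℝ)⁻¹ * ∑ k, h (t k) ^ p) ^ (1 / p) + δ * D) ^ p) ≤
      worstCaseRisk c p δ L (empirical z) := by
  have hp0 : 0 < p := zero_lt_one.trans_le hp
  set m := (N : ℝ)⁻¹ * ∑ k, h (t k) ^ p with hm_def
  -- Observation `k` is shifted by `δ / R * h (t k)` up to sign: since the mean of `h (t k) ^ p` is
  -- `R ^ p`, the mean `p`-th power of the shifts is at most `δ ^ p`.
  set R := m ^ (1 / p) with hR_def
  have hR : 0 < R := by positivity
  have hRm : R ^ p = m := by rw [hR_def, one_div, Real.rpow_inv_rpow hm.le hp0.ne']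
  -- Where the loss vanishes the shift is zero, so no direction of growth is needed there.
  have hdir : ∀ k, ∃ ε : ℝ, |ε| ≤ 1 ∧
      h (t k) + δ / R * h (t k) * D ≤ h (t k + ε * (δ / R * h (t k)) * D) := fun k => by
    rcases (hh.nonneg (t k)).eq_or_lt with h0 | h0
    · exact ⟨0, by simp, by simp [← h0]⟩
    · obtain ⟨ε, hε, h1⟩ := hh.exists_direction h0
      refine ⟨ε, hε.le, ?_⟩
      rw [mul_assoc ε]
      exact h1 _ (by positivity)
  choose ε hε hgrow using hdir
  have hcost : ∑ k, (N : ℝ≥0∞)⁻¹ * c (z k) (q k (ε k * (δ / R * h (t k)))) ^ p ≤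
      ENNReal.ofReal δ ^ p := by
    calc ∑ k, (N : ℝ≥0∞)⁻¹ * c (z k) (q k (ε k * (δ / R * h (t k)))) ^ p
        ≤ ∑ k, (N : ℝ≥0∞)⁻¹ * ENNReal.ofReal ((δ / R) ^ p * h (t k) ^ p) := by
          gcongr with k
          have hs : 0 ≤ δ / R * h (t k) := mul_nonneg (by positivity) (hh.nonneg _)
          rw [← Real.mul_rpow (by positivity) (hh.nonneg _),
            ← ENNReal.ofReal_rpow_of_nonneg hs hp0.le]
          refine ENNReal.rpow_le_rpow ((hc _ _).trans (ENNReal.ofReal_le_ofReal ?_)) hp0.le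
          rw [abs_mul, abs_of_nonneg hs]
          exact mul_le_of_le_one_left hs (hε k)
      _ = ENNReal.ofReal δ ^ p := by
          rw [inv_mul_sum_ofReal _ fun k =>
              mul_nonneg (by positivity) (Real.rpow_nonneg (hh.nonneg _) _),
            ← Finset.mul_sum, mul_left_comm, ← hm_def, ← hRm,
            ← Real.mul_rpow (by positivity) hR.le, div_mul_cancel₀ _ hR.ne',
            ENNReal.ofReal_rpow_of_nonneg hδ hp0.le]
  refine le_trans ?_ (sum_le_worstCaseRisk (J := Fin N) hp0 (fun _ => (N : ℝ≥0∞)⁻¹) z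
    (fun k => q k (ε k * (δ / R * h (t k)))) sum_inv_natCast_eq_one
    (sum_smul_dirac_eq_empirical z) hcost)
  rw [inv_mul_sum_ofReal _ fun k => by rw [hL]; exact Real.rpow_nonneg (hh.nonneg _) _]
  refine ENNReal.ofReal_le_ofReal ?_
  -- Every loss is multiplied by the same factor `1 + δ / R * D`, which is the equality case of
  -- Minkowski's inequality.
  have e : (R + δ * D) ^ p = (N : ℝ)⁻¹ * ∑ k, (h (t k) + δ / R * h (t k) * D) ^ p := by
    have e1 : R + δ * D = R * (1 + δ / R * D) := by field_simp
    have e2 : ∀ k, (h (t k) + δ / R * h (t k) * D) ^ p = h (t k) ^ p * (1 + δ / R * D) ^ p :=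
      fun k => by rw [← Real.mul_rpow (hh.nonneg _) (by positivity)]; ring_nf
    rw [e1, Real.mul_rpow hR.le (by positivity), hRm, Finset.sum_congr rfl fun k _ => e2 k,
      ← Finset.sum_mul, ← mul_assoc]
  rw [e]
  gcongr with k
  rw [hL]
  have := hh.nonneg (t k)
  exact Real.rpow_le_rpow (by positivity) (hgrow k) hp0.le

/-- Moving a vanishing fraction of the mass far away gains the full regularization. -/
theorem ofReal_mul_rpow_le_worstCaseRisk (hh : IsBaseLoss h) (hp : 1 ≤ p) (hδ : 0 ≤ δ)
    (hD : 0 ≤ D) (hq : ∀ k, c (z k) (z k) = 0)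
    (hc : ∀ k s, c (z k) (q k s) ≤ ENNReal.ofReal |s|)
    (hL : ∀ k s, L (q k s) = h (t k + s * D) ^ p) :
    ENNReal.ofReal ((δ * D) ^ p) ≤ worstCaseRisk c p δ L (empirical z) := by
  have hp0 : 0 < p := zero_lt_one.trans_le hp
  choose C hC0 hC using fun k => hh.exists_sub_le (t k)
  have hCle : ∀ k, C k ≤ ∑ j, C j := fun k =>
    Finset.single_le_sum (fun j _ => hC0 j) (Finset.mem_univ k)
  -- Of each atom the fraction `η ^ p` travels the distance `δ / η`, at cost at most `δ ^ p`. Its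
  -- loss contributes at least `(η * (δ / η * D - C k)) ^ p` when the base is nonnegative, which
  -- tends to `(δ * D) ^ p` as `η → 0`.
  have key : ∀ η ∈ Set.Ioc (0 : ℝ) 1, ENNReal.ofReal ((max 0 (δ * D - η * ∑ j, C j)) ^ p) ≤
      worstCaseRisk c p δ L (empirical z) := by
    rintro η ⟨hη0, hη1⟩
    have hη : η ^ p ≤ 1 := Real.rpow_le_one hη0.le hη1 hp0.le
    have hsplit : ENNReal.ofReal (η ^ p) + ENNReal.ofReal (1 - η ^ p) = 1 := by
      rw [← ENNReal.ofReal_add (by positivity) (by linarith)]; simp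
    have hcost : ∀ k, c (z k) (q k (δ / η)) ^ p * ENNReal.ofReal (η ^ p) ≤
        ENNReal.ofReal δ ^ p := fun k => by
      rw [← ENNReal.ofReal_rpow_of_nonneg hη0.le hp0.le, ← ENNReal.mul_rpow_of_nonneg _ _ hp0.le]
      refine ENNReal.rpow_le_rpow ?_ hp0.le
      calc c (z k) (q k (δ / η)) * ENNReal.ofReal η
          ≤ ENNReal.ofReal |δ / η| * ENNReal.ofReal η := by gcongr; exact hc _ _
        _ = ENNReal.ofReal δ := by
          rw [← ENNReal.ofReal_mul (abs_nonneg _), abs_of_nonneg (by positivity),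
            div_mul_cancel₀ _ hη0.ne']
    -- The Boolean index splits each atom: `true` marks the part that moves, `false` the part that
    -- stays.
    refine le_trans ?_ (sum_le_worstCaseRisk (J := Fin N × Bool) hp0
      (fun j => (N : ℝ≥0∞)⁻¹ * ENNReal.ofReal (if j.2 then η ^ p else 1 - η ^ p))
      (fun j => z j.1) (fun j => if j.2 then q j.1 (δ / η) else z j.1) ?_ ?_ ?_)
    · rw [Fintype.sum_prod_type]
      calc ENNReal.ofReal ((max 0 (δ * D - η * ∑ j, C j)) ^ p)
          = ∑ _k : Fin N, (N : ℝ≥0∞)⁻¹ *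
            ENNReal.ofReal ((max 0 (δ * D - η * ∑ j, C j)) ^ p) := by
            rw [← Finset.sum_mul, sum_inv_natCast_eq_one, one_mul]
        _ ≤ _ := by
            refine Finset.sum_le_sum fun k _ => ?_
            rw [Fintype.sum_bool]
            refine le_trans ?_ le_self_add
            simp only [if_true]
            rw [mul_assoc, ← ENNReal.ofReal_mul (by positivity), hL,
              ← Real.mul_rpow hη0.le (hh.nonneg _)]
            gcongr
            refine max_le (mul_nonneg hη0.le (hh.nonneg _)) ?_
            have h1 := hC k (δ / η * D)
            have h2 := mul_le_mul_of_nonneg_left h1 hη0.le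
            have h3 : η * (δ / η * D - C k) = δ * D - η * C k := by field_simp
            have h4 := mul_le_mul_of_nonneg_left (hCle k) hη0.le
            linarith
    · rw [Fintype.sum_prod_type]
      simp only [Fintype.sum_bool, if_true, Bool.false_eq_true, if_false, ← mul_add, hsplit,
        mul_one]
      exact sum_inv_natCast_eq_one
    · rw [Fintype.sum_prod_type]
      simp only [Fintype.sum_bool, if_true, Bool.false_eq_true, if_false, ← add_smul, ← mul_add,
        hsplit, mul_one]
      exact sum_smul_dirac_eq_empirical z
    · rw [Fintype.sum_prod_type]
      simp only [Fintype.sum_bool, if_true, Bool.false_eq_true, if_false, hq,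
        ENNReal.zero_rpow_of_pos hp0, mul_zero, add_zero]
      calc _ ≤ ∑ _k : Fin N, (N : ℝ≥0∞)⁻¹ * ENNReal.ofReal δ ^ p := by
            refine Finset.sum_le_sum fun k _ => ?_
            rw [mul_assoc, mul_comm (ENNReal.ofReal _)]
            gcongr
            exact hcost k
        _ = ENNReal.ofReal δ ^ p := by rw [← Finset.sum_mul, sum_inv_natCast_eq_one, one_mul]
  have hcont : Continuous fun η : ℝ =>
      ENNReal.ofReal ((max 0 (δ * D - η * ∑ j, C j)) ^ p) := by
    refine ENNReal.continuous_ofReal.comp (Continuous.rpow_const (by fun_prop) fun _ => ?_)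
    exact Or.inr hp0.le
  have hlim := (hcont.tendsto 0).mono_left (nhdsWithin_le_nhds (s := Set.Ioi 0))
  rw [zero_mul, sub_zero, max_eq_right (by positivity)] at hlim
  exact le_of_tendsto hlim (Filter.eventually_of_mem (Ioc_mem_nhdsGT zero_lt_one) key)

/-- The proportional shifts divide by the mean loss, so the case of mean zero needs the far
transport of a small mass instead. -/
theorem add_rpow_le_worstCaseRisk (hh : IsBaseLoss h) (hp : 1 ≤ p) (hδ : 0 ≤ δ) (hD : 0 ≤ D)
    (hq : ∀ k, c (z k) (z k) = 0)
    (hc : ∀ k s, c (z k) (q k s) ≤ ENNReal.ofReal |s|)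
    (hL : ∀ k s, L (q k s) = h (t k + s * D) ^ p) :
    (((N : ℝ≥0∞)⁻¹ * ∑ k, ENNReal.ofReal (h (t k) ^ p)) ^ (1 / p) + ENNReal.ofReal (δ * D)) ^ p ≤
      worstCaseRisk c p δ L (empirical z) := by
  have hp0 : 0 < p := zero_lt_one.trans_le hp
  have hnn : ∀ k, 0 ≤ h (t k) ^ p := fun k => Real.rpow_nonneg (hh.nonneg _) _
  have hm : 0 ≤ (N : ℝ)⁻¹ * ∑ k, h (t k) ^ p :=
    mul_nonneg (by positivity) (Finset.sum_nonneg fun k _ => hnn k)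
  rw [Finset.mul_sum, inv_mul_sum_ofReal _ hnn, ENNReal.ofReal_rpow_of_nonneg hm (by positivity),
    ← ENNReal.ofReal_add (by positivity) (by positivity),
    ENNReal.ofReal_rpow_of_nonneg (by positivity) hp0.le]
  rcases hm.eq_or_lt with h0 | h0
  · rw [← h0, Real.zero_rpow (by positivity), zero_add]
    exact ofReal_mul_rpow_le_worstCaseRisk hh hp hδ hD hq hc hL
  · exact le_worstCaseRisk_of_pos hh hp hδ hD hc hL h0

end Growth

/-! ### The loss in semi-latent coordinates -/

namespace LearningTask

/-- The losses are `h (offset y + slope y * ⟨θ, v⟩)`. -/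
def offset : LearningTask → ℝ → ℝ
  | .regression, y => y
  | .classification, _ => 0

/-- The losses are `h (offset y + slope y * ⟨θ, v⟩)`. -/
def slope : LearningTask → ℝ → ℝ
  | .regression, _ => -1
  | .classification, y => y

theorem continuous_offset (T : LearningTask) : Continuous T.offset := by
  cases T
  · exact continuous_id
  · exact continuous_const

theorem continuous_slope (T : LearningTask) : Continuous T.slope := by
  cases T
  · exact continuous_const
  · exact continuous_id

/-- Labels `±1` matter only here: they let a change of `⟨θ, v⟩` enter the argument of `h` without
rescaling. -/
theorem abs_slope (T : LearningTask) {y : ℝ} (hy : T = .classification → y = 1 ∨ y = -1) :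
    |T.slope y| = 1 := by
  cases T
  · simp [slope]
  · rcases hy rfl with rfl | rfl <;> simp [slope]

end LearningTask

theorem linearLoss_eq {ι : Type*} [Fintype ι] (T : LearningTask) (h : ℝ → ℝ) (θ v : ι → ℝ)
    (y : ℝ) : linearLoss T h θ v y = h (T.offset y + T.slope y * (θ ⬝ᵥ v)) := by
  cases T
  · simp [linearLoss, LearningTask.offset, LearningTask.slope, sub_eq_add_neg]
  · simp [linearLoss, LearningTask.offset, LearningTask.slope]

theorem linearLoss_nonneg {ι : Type*} [Fintype ι] {h : ℝ → ℝ} {T : LearningTask} {θ : ι → ℝ}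
    (hh : IsBaseLoss h) (v : ι → ℝ) (y : ℝ) :
    0 ≤ linearLoss T h θ v y := by
  rw [linearLoss_eq]; exact hh.nonneg _

theorem continuous_linearLoss_rpow {ι : Type*} [Fintype ι] {I : Finset ι} {A : Set (I → ℝ)}
    {p : ℝ} {h : ℝ → ℝ} {T : LearningTask} {θ : ι → ℝ} (hh : IsBaseLoss h) (hp : 0 ≤ p) :
    Continuous fun z : featureSpace I A × ℝ => linearLoss T h θ z.1 z.2 ^ p := by
  refine Continuous.rpow_const ?_ fun _ => Or.inr hp
  simp_rw [linearLoss_eq]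
  have h1 := T.continuous_offset
  have h2 := T.continuous_slope
  have h3 : ∀ i, Continuous fun z : featureSpace I A × ℝ => (z.1 : ι → ℝ) i := fun i =>
    (continuous_apply i).comp (continuous_subtype_val.comp continuous_fst)
  refine hh.continuous.comp ?_
  unfold dotProduct
  fun_prop

theorem nonempty_levels {ι : Type*} {I : Finset ι} {A : Set (I → ℝ)} (v : featureSpace I A) :
    Nonempty A := ⟨⟨_, v.2⟩⟩

/-! ### ### The worst-case risk for the causally fair cost -/

section Main

variable {ι : Type*} [DecidableEq ι] {S : AdditiveNoiseModel ι} {I : Finset ι}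
  {A : Set (I → ℝ)} {ν : Seminorm ℝ ({i // i ∉ I} → ℝ)} {p δ : ℝ} {h : ℝ → ℝ} {T : LearningTask}
  {θ : ι → ℝ}

theorem fairCost_self (z : featureSpace I A × ℝ) : fairCost S I A ν z z = 0 := by
  simp [fairCost]

/-- In `ℝ≥0∞` the product `⊤ * r` is `0` for `r = 0` and `⊤` otherwise, so the label term is a hard
constraint. -/
theorem eq_of_fairCost_ne_top {z z' : featureSpace I A × ℝ} (hc : fairCost S I A ν z z' ≠ ⊤) :
    z.2 = z'.2 := by
  by_contra hne
  refine hc ?_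
  have : ENNReal.ofReal |z.2 - z'.2| ≠ 0 := by
    simpa [sub_eq_zero] using hne
  rw [fairCost, ENNReal.top_mul this, add_top]

variable [Fintype ι]

theorem linearLoss_ofParts (hS : S.IsLinear) (a : I → ℝ) (x : {i // i ∉ I} → ℝ) (y : ℝ) :
    linearLoss T h θ (S.ofParts I a x) y =
      h (T.offset y + T.slope y * (sensitivePart I ((S.semiLatentMatrix I)ᵀ *ᵥ θ) ⬝ᵥ a +
        nonsensitivePart I ((S.semiLatentMatrix I)ᵀ *ᵥ θ) ⬝ᵥ x)) := by
  rw [linearLoss_eq, S.dotProduct_ofParts I hS]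

theorem linearLoss_twin (hS : S.IsLinear) (v : ι → ℝ) (a : I → ℝ) (y : ℝ) :
    linearLoss T h θ (S.twin I v a) y =
      h (T.offset y + T.slope y * (sensitivePart I ((S.semiLatentMatrix I)ᵀ *ᵥ θ) ⬝ᵥ a +
        nonsensitivePart I ((S.semiLatentMatrix I)ᵀ *ᵥ θ) ⬝ᵥ
          nonsensitivePart I (S.semiLatent I v))) := by
  rw [S.twin_eq_ofParts, linearLoss_ofParts hS]

/-- The levels may be uncountable, so measurability comes from lower semicontinuity of a supremum of
continuous functions. -/
theorem measurable_iSup_twin (hS : S.IsLinear) (hh : IsBaseLoss h) (hp : 0 ≤ p) :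
    Measurable fun z : featureSpace I A × ℝ =>
      ⨆ a : A, ENNReal.ofReal (linearLoss T h θ (S.twin I z.1 a) z.2 ^ p) := by
  refine (lowerSemicontinuous_iSup fun a => Continuous.lowerSemicontinuous ?_).measurable
  refine ENNReal.continuous_ofReal.comp (Continuous.rpow_const ?_ fun _ => Or.inr hp)
  simp_rw [linearLoss_twin hS]
  have h1 := T.continuous_offset
  have h2 := T.continuous_slope
  have h3 := S.continuous_nonsensitivePart_semiLatent I hS
  refine hh.continuous.comp ?_
  unfold dotProduct
  have h4 : ∀ i, Continuous fun z : featureSpace I A × ℝ =>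
      nonsensitivePart I (S.semiLatent I z.1) i := fun i =>
    (continuous_apply i).comp (h3.comp (continuous_subtype_val.comp continuous_fst))
  fun_prop

theorem measurable_transport_nonsensitivePart (hS : S.IsLinear) :
    Measurable fun z : (featureSpace I A × ℝ) × (featureSpace I A × ℝ) =>
      ENNReal.ofReal (ν (nonsensitivePart I (S.semiLatent I z.1.1) -
        nonsensitivePart I (S.semiLatent I z.2.1))) := by
  have h3 := S.continuous_nonsensitivePart_semiLatent I hS
  refine (ENNReal.continuous_ofReal.comp (ν.continuous_of_fintype.comp (Continuous.sub ?_ ?_))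
    ).measurable
  · exact h3.comp (continuous_subtype_val.comp (continuous_fst.comp continuous_fst))
  · exact h3.comp (continuous_subtype_val.comp (continuous_fst.comp continuous_snd))

theorem measurable_fairCost (hS : S.IsLinear) :
    Measurable fun z : (featureSpace I A × ℝ) × (featureSpace I A × ℝ) =>
      fairCost S I A ν z.1 z.2 := by
  unfold fairCost
  refine (measurable_transport_nonsensitivePart hS).add (Measurable.const_mul ?_ _)
  exact (ENNReal.continuous_ofReal.comp (by fun_prop)).measurable

/-- The point of the feature space with semi-latent coordinates `(a, x)`, labelled by `y`. -/
noncomputable def labelledOfParts (S : AdditiveNoiseModel ι) (a : A) (x : {i // i ∉ I} → ℝ)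
    (y : ℝ) : featureSpace I A × ℝ :=
  (⟨S.ofParts I a x, by
    change sensitivePart I _ ∈ A
    rw [S.sensitivePart_ofParts]; exact a.2⟩, y)

/-- The level `a` is absent from the right-hand side: switching it is free, which is how the
counterfactual supremum enters the worst case. -/
theorem fairCost_labelledOfParts (z : featureSpace I A × ℝ) (a : A) (x : {i // i ∉ I} → ℝ) :
    fairCost S I A ν z (labelledOfParts S a x z.2) =
      ENNReal.ofReal (ν (nonsensitivePart I (S.semiLatent I z.1) - x)) := by
  simp [fairCost, labelledOfParts, S.nonsensitivePart_semiLatent_ofParts]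

/-- Compared with the twin at the same sensitive level, the loss grows at most by the dual norm
times the transport distance. -/
theorem linearLoss_le_twin_add (hS : S.IsLinear) (hν : ∀ x, ν x = 0 → x = 0) (hh : IsBaseLoss h)
    {y : ℝ} (hy : |T.slope y| = 1) (v v' : ι → ℝ) :
    linearLoss T h θ v' y ≤ linearLoss T h θ (S.twin I v (sensitivePart I v')) y +
      dualNorm ν (nonsensitivePart I ((S.semiLatentMatrix I)ᵀ *ᵥ θ)) *
        ν (nonsensitivePart I (S.semiLatent I v) - nonsensitivePart I (S.semiLatent I v')) := by
  conv_lhs => rw [← S.ofParts_parts I v']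
  rw [linearLoss_ofParts hS, linearLoss_twin hS]
  refine (hh.le_add_abs_sub _ _).trans (add_le_add_right (le_of_eq_of_le ?_
    (abs_dotProduct_le_dualNorm_mul ν hν _ _)) _)
  rw [add_sub_add_left_eq_sub, ← mul_sub, add_sub_add_left_eq_sub, abs_mul, hy, one_mul,
    abs_sub_comm, ← dotProduct_sub]

/-- The target `v'` is compared with the twin of `v` at the sensitive level of `v'`. This level is
admissible, so the supremum over twins dominates it. -/
theorem worstCaseRisk_fairCost_le (hS : S.IsLinear) (hν : ∀ x, ν x = 0 → x = 0) (hp : 1 ≤ p)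
    (hh : IsBaseLoss h) {N : ℕ} [NeZero N] (z : Fin N → featureSpace I A × ℝ)
    (hz : T = .classification → ∀ k, (z k).2 = 1 ∨ (z k).2 = -1) :
    worstCaseRisk (fairCost S I A ν) p δ (fun z => linearLoss T h θ z.1 z.2 ^ p) (empirical z) ≤
      (counterfactualRisk S I A (fun v y => linearLoss T h θ v y ^ p) (empirical z) ^ (1 / p) +
        ENNReal.ofReal (dualNorm ν (nonsensitivePart I ((S.semiLatentMatrix I)ᵀ *ᵥ θ))) *
          ENNReal.ofReal δ) ^ p := by
  have hp0 : 0 < p := zero_lt_one.trans_le hp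
  refine worstCaseRisk_le (q := fun z => |T.slope z.2| = 1)
    (L := fun z : featureSpace I A × ℝ => linearLoss T h θ z.1 z.2 ^ p)
    (F := fun z => ⨆ a : A, ENNReal.ofReal (linearLoss T h θ (S.twin I z.1 a) z.2 ^ p))
    (G := fun z z' => ENNReal.ofReal (ν (nonsensitivePart I (S.semiLatent I z.1) -
      nonsensitivePart I (S.semiLatent I z'.1)))) hp _
    (continuous_linearLoss_rpow hh hp0.le).measurable (measurable_iSup_twin hS hh hp0.le)
    (measurable_transport_nonsensitivePart hS) (fun z z' => le_self_add)
    (ae_empirical z fun k => T.abs_slope fun hT => hz hT k) (measurable_fairCost hS) ?_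
  rintro ⟨v, y⟩ ⟨v', y'⟩ hy hc
  obtain rfl : y = y' := eq_of_fairCost_ne_top hc
  have hD : 0 ≤ dualNorm ν (nonsensitivePart I ((S.semiLatentMatrix I)ᵀ *ᵥ θ)) :=
    dualNorm_nonneg ν hν _
  have hlip := linearLoss_le_twin_add (θ := θ) hS hν hh hy v v'
  dsimp only
  rw [← ENNReal.ofReal_rpow_of_nonneg (linearLoss_nonneg hh _ _) hp0.le]
  refine ENNReal.rpow_le_rpow ((ENNReal.ofReal_le_ofReal hlip).trans ?_) hp0.le
  rw [ENNReal.ofReal_add (linearLoss_nonneg hh _ _) (mul_nonneg hD (apply_nonneg _ _)),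
    ENNReal.ofReal_mul hD]
  refine add_le_add_left ?_ _
  rw [one_div, ENNReal.le_rpow_inv_iff hp0,
    ENNReal.ofReal_rpow_of_nonneg (linearLoss_nonneg hh _ _) hp0.le]
  exact le_iSup (fun a : A => ENNReal.ofReal (linearLoss T h θ (S.twin I v a) y ^ p))
    ⟨sensitivePart I v', v'.2⟩

/-- The level can be chosen separately for each observation, so supremum and finite sum commute.
Since the suprema need not be attained, the lower bound is proved for one choice `α` at a time. -/
theorem counterfactualRisk_empirical {N : ℕ} [NeZero N] (z : Fin N → featureSpace I A × ℝ)
    (L : (ι → ℝ) → ℝ → ℝ) :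
    counterfactualRisk S I A L (empirical z) = ⨆ α : Fin N → A,
      (N : ℝ≥0∞)⁻¹ * ∑ k, ENNReal.ofReal (L (S.twin I (z k).1 (α k)) (z k).2) := by
  have := nonempty_levels (z 0).1
  rw [counterfactualRisk, lintegral_empirical, ← ENNReal.mul_iSup]
  congr 1
  rw [← ENNReal.finsetSum_iSup]
  · refine Finset.sum_congr rfl fun k _ => ?_
    exact ((Function.surjective_eval (β := fun _ : Fin N => A) k).iSup_comp fun a : A =>
      ENNReal.ofReal (L (S.twin I (z k).1 a) (z k).2)).symm
  -- The family is directed: at each observation take the better of the two levels.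
  · intro α β
    refine ⟨fun k => if ENNReal.ofReal (L (S.twin I (z k).1 (α k)) (z k).2) ≤
      ENNReal.ofReal (L (S.twin I (z k).1 (β k)) (z k).2) then β k else α k, fun k => ?_⟩
    dsimp only
    split_ifs with hk
    · exact ⟨hk, le_rfl⟩
    · exact ⟨le_rfl, (not_le.1 hk).le⟩

theorem le_worstCaseRisk_fairCost (hS : S.IsLinear) (hν : ∀ x, ν x = 0 → x = 0) (hp : 1 ≤ p)
    (hδ : 0 ≤ δ) (hh : IsBaseLoss h) {N : ℕ} [NeZero N] (z : Fin N → featureSpace I A × ℝ)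
    (hz : T = .classification → ∀ k, (z k).2 = 1 ∨ (z k).2 = -1) (α : Fin N → A) :
    (((N : ℝ≥0∞)⁻¹ *
        ∑ k, ENNReal.ofReal (linearLoss T h θ (S.twin I (z k).1 (α k)) (z k).2 ^ p)) ^ (1 / p) +
      ENNReal.ofReal (δ * dualNorm ν (nonsensitivePart I ((S.semiLatentMatrix I)ᵀ *ᵥ θ)))) ^ p ≤
    worstCaseRisk (fairCost S I A ν) p δ (fun z => linearLoss T h θ z.1 z.2 ^ p)
      (empirical z) := by
  obtain ⟨d, hd, hdw, -⟩ := exists_dotProduct_eq_dualNorm ν hν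
    (nonsensitivePart I ((S.semiLatentMatrix I)ᵀ *ᵥ θ))
  have hslope : ∀ k, |T.slope (z k).2| = 1 := fun k => T.abs_slope fun hT => hz hT k
  simp_rw [linearLoss_twin hS]
  refine add_rpow_le_worstCaseRisk hh hp hδ (dualNorm_nonneg ν hν _) (fun k => fairCost_self _)
    -- At `s = 0` this is the twin at level `α k`, reached at no cost. The factor `slope` cancels
    -- the one in the loss, as its square is `1`.
    (q := fun k s => labelledOfParts S (α k)
      (nonsensitivePart I (S.semiLatent I (z k).1) + (T.slope (z k).2 * s) • d) (z k).2)
    (fun k s => ?_) (fun k s => ?_)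
  · rw [fairCost_labelledOfParts]
    refine ENNReal.ofReal_le_ofReal ?_
    rw [sub_add_cancel_left, map_neg_eq_map, map_smul_eq_mul, Real.norm_eq_abs, abs_mul, hslope,
      one_mul]
    exact mul_le_of_le_one_right (abs_nonneg s) hd
  · simp only [labelledOfParts]
    rw [linearLoss_ofParts hS, dotProduct_add, dotProduct_smul, hdw, smul_eq_mul]
    have hsq : T.slope (z k).2 * T.slope (z k).2 = 1 := by
      rw [← abs_mul_abs_self, hslope, one_mul]
    congr 2
    linear_combination s * dualNorm ν (nonsensitivePart I ((S.semiLatentMatrix I)ᵀ *ᵥ θ)) * hsq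

/-- The worst-case risk is the regularized counterfactual risk, for any set of levels. -/
theorem worstCaseRisk_fairCost_eq (hS : S.IsLinear) (hν : ∀ x, ν x = 0 → x = 0) (hp : 1 ≤ p)
    (hδ : 0 ≤ δ) (hh : IsBaseLoss h) {N : ℕ} [NeZero N] (z : Fin N → featureSpace I A × ℝ)
    (hz : T = .classification → ∀ k, (z k).2 = 1 ∨ (z k).2 = -1) :
    worstCaseRisk (fairCost S I A ν) p δ (fun z => linearLoss T h θ z.1 z.2 ^ p) (empirical z) =
      (counterfactualRisk S I A (fun v y => linearLoss T h θ v y ^ p) (empirical z) ^ (1 / p) +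
        ENNReal.ofReal (δ * dualNorm ν (nonsensitivePart I ((S.semiLatentMatrix I)ᵀ *ᵥ θ))))
          ^ p := by
  have hp0 : 0 < p := zero_lt_one.trans_le hp
  refine le_antisymm ?_ ?_
  · rw [ENNReal.ofReal_mul hδ, mul_comm (ENNReal.ofReal δ)]
    exact worstCaseRisk_fairCost_le hS hν hp hh z hz
  · set W := worstCaseRisk (fairCost S I A ν) p δ (fun z => linearLoss T h θ z.1 z.2 ^ p)
      (empirical z) with hW
    set reg := ENNReal.ofReal
      (δ * dualNorm ν (nonsensitivePart I ((S.semiLatentMatrix I)ᵀ *ᵥ θ))) with hreg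
    have hα := le_worstCaseRisk_fairCost (θ := θ) hS hν hp hδ hh z hz
    simp only [← hW, ← hreg] at hα
    have := nonempty_levels (z 0).1
    -- This makes truncated subtraction of `reg` exact, so that the supremum over `α` can be
    -- isolated on the left.
    have hregW : reg ≤ W ^ (1 / p) := by
      rw [one_div, ENNReal.le_rpow_inv_iff hp0]
      exact (ENNReal.rpow_le_rpow le_add_self hp0.le).trans (hα (Classical.arbitrary _))
    rw [← ENNReal.le_rpow_inv_iff hp0, ← one_div p]
    refine add_le_of_le_tsub_right_of_le hregW ?_
    rw [one_div, ENNReal.rpow_inv_le_iff hp0, counterfactualRisk_empirical, ← one_div p]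
    refine iSup_le fun α => ?_
    rw [← ENNReal.rpow_inv_le_iff hp0, ← one_div p]
    refine ENNReal.le_sub_of_add_le_right ENNReal.ofReal_ne_top ?_
    rw [one_div p, ENNReal.le_rpow_inv_iff hp0, ← one_div p]
    exact hα α

theorem counterfactualRisk_eq_risk (hS : S.IsLinear)
    (hw : sensitivePart I ((S.semiLatentMatrix I)ᵀ *ᵥ θ) = 0)
    (P : ProbabilityMeasure (featureSpace I A × ℝ)) :
    counterfactualRisk S I A (fun v y => linearLoss T h θ v y ^ p) P =
      risk (fun z : featureSpace I A × ℝ => linearLoss T h θ z.1 z.2 ^ p) P := by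
  refine lintegral_congr fun z => ?_
  have := nonempty_levels z.1
  have key : ∀ a : A, linearLoss T h θ (S.twin I z.1 a) z.2 = linearLoss T h θ z.1 z.2 :=
    fun a => by
      conv_rhs => rw [← S.ofParts_parts I z.1]
      rw [linearLoss_twin hS, linearLoss_ofParts hS, hw, zero_dotProduct, zero_dotProduct]
  simp only [key, iSup_const]

/-- One observation with infinite supremum suffices, since its weight is positive. There the
argument of `h` differs from the functional `⟨e • w, a⟩` by a constant, which changes `h` by a
bounded amount. -/
theorem counterfactualRisk_eq_top (hS : S.IsLinear) (hp : 1 ≤ p) (hh : IsBaseLoss h)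
    {N : ℕ} [NeZero N] (z : Fin N → featureSpace I A × ℝ)
    (hz : T = .classification → ∀ k, (z k).2 = 1 ∨ (z k).2 = -1)
    (hA : ∀ w : I → ℝ, w ≠ 0 → ¬ BddAbove ((fun a => h (w ⬝ᵥ a)) '' A))
    (hw : sensitivePart I ((S.semiLatentMatrix I)ᵀ *ᵥ θ) ≠ 0) :
    counterfactualRisk S I A (fun v y => linearLoss T h θ v y ^ p) (empirical z) = ⊤ := by
  rw [counterfactualRisk, lintegral_empirical, ENNReal.mul_eq_top]
  refine Or.inl ⟨by simp, ENNReal.sum_eq_top.2 ⟨0, Finset.mem_univ _, ?_⟩⟩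
  simp_rw [linearLoss_twin hS]
  set e := T.slope (z 0).2
  set b := T.offset (z 0).2
  set w := sensitivePart I ((S.semiLatentMatrix I)ᵀ *ᵥ θ)
  set s := nonsensitivePart I ((S.semiLatentMatrix I)ᵀ *ᵥ θ) ⬝ᵥ
    nonsensitivePart I (S.semiLatent I (z 0).1)
  have he : e ≠ 0 := fun h0 => by
    have : |e| = 1 := T.abs_slope fun hT => hz hT 0
    simp [h0] at this
  refine ENNReal.eq_top_of_forall_nnreal_le fun r => ?_
  have hnb := hA (e • w) (smul_ne_zero he hw)
  rw [not_bddAbove_iff] at hnb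
  -- The summand `|b + e * s|` pays for the constant shift; the `1` in the maximum ensures that
  -- raising to the power `p` does not decrease the value.
  obtain ⟨_, ⟨a, ha, rfl⟩, hlt⟩ := hnb (max 1 r + |b + e * s|)
  refine le_trans ?_ (le_iSup (fun a : A => ENNReal.ofReal (h (b + e * (w ⬝ᵥ a + s)) ^ p)) ⟨a, ha⟩)
  have hlip := hh.le_add_abs_sub ((e • w) ⬝ᵥ a) (b + e * (w ⬝ᵥ a + s))
  have hsub : (e • w) ⬝ᵥ a - (b + e * (w ⬝ᵥ a + s)) = -(b + e * s) := by
    rw [smul_dotProduct, smul_eq_mul]; ring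
  rw [hsub, abs_neg] at hlip
  have hge : max 1 (r : ℝ) ≤ h (b + e * (w ⬝ᵥ a + s)) := by
    have hlt : max 1 (r : ℝ) + |b + e * s| < h ((e • w) ⬝ᵥ a) := hlt
    linarith
  rw [← ENNReal.ofReal_coe_nnreal]
  refine ENNReal.ofReal_le_ofReal ?_
  calc (r : ℝ) ≤ h (b + e * (w ⬝ᵥ a + s)) := (le_max_right _ _).trans hge
    _ ≤ _ := Real.self_le_rpow_of_one_le ((le_max_left _ _).trans hge) hp

end Main

theorem theorem2 {ι : Type*} [Fintype ι] [DecidableEq ι]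
    -- a linear SCM, the sensitive indices, the sensitive levels, and a norm on the rest
    (S : AdditiveNoiseModel ι) (hS : S.IsLinear) (I : Finset ι) (A : Set (I → ℝ))
    (ν : Seminorm ℝ ({i // i ∉ I} → ℝ)) (hν : ∀ x, ν x = 0 → x = 0)
    (p : ℝ) (hp : 1 ≤ p) (δ : ℝ) (hδ : 0 ≤ δ)
    (h : ℝ → ℝ) (hh : IsBaseLoss h) (T : LearningTask) (θ : ι → ℝ)
    -- the observations; labels are `±1` in classification
    {N : ℕ} [NeZero N] (z : Fin N → featureSpace I A × ℝ)
    (hz : T = .classification → ∀ k, (z k).2 = 1 ∨ (z k).2 = -1) :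
    let L : (ι → ℝ) → ℝ → ℝ := fun v y => linearLoss T h θ v y ^ p
    let LZ : featureSpace I A × ℝ → ℝ := fun z => L z.1 z.2
    let Mθ : ι → ℝ := (S.semiLatentMatrix I)ᵀ *ᵥ θ
    let reg : ℝ≥0∞ := ENNReal.ofReal (δ * dualNorm ν (nonsensitivePart I Mθ))
    let worst : ℝ≥0∞ := worstCaseRisk (fairCost S I A ν) p δ LZ (empirical z)
    (Metric.ediam A < ⊤ →
      worst = (counterfactualRisk S I A L (empirical z) ^ (1 / p) + reg) ^ p) ∧
    (Metric.ediam A = ⊤ →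
      -- the formula under the constraint
      (sensitivePart I Mθ = 0 → worst = (risk LZ (empirical z) ^ (1 / p) + reg) ^ p) ∧
      -- the constraint is necessary
      ((∀ w : I → ℝ, w ≠ 0 → ¬ BddAbove ((fun a => h (w ⬝ᵥ a)) '' A)) →
        sensitivePart I Mθ ≠ 0 → worst = ⊤)) := by
  intro L LZ Mθ reg worst
  have hp0 : 0 < p := zero_lt_one.trans_le hp
  have key : worst = (counterfactualRisk S I A L (empirical z) ^ (1 / p) + reg) ^ p :=
    worstCaseRisk_fairCost_eq hS hν hp hδ hh z hz
  refine ⟨fun _ => key, fun _ => ⟨fun hw => ?_, fun hA hw => ?_⟩⟩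
  · rw [key, counterfactualRisk_eq_risk hS hw]
  · rw [key, counterfactualRisk_eq_top hS hp hh z hz hA hw, ENNReal.top_rpow_of_pos (by positivity),
      top_add, ENNReal.top_rpow_of_pos hp0]
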